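/- **Theorem.** For a map $f$ from a finite metric space $(X,d_X)$ to a metric space $(Y,d_Y)$ put $$\mathrm{dist}(f)=\Bigl(\sup_{d_X(x,y)\neq 0}\frac{d_Y(f(x),f(y))}{d_X(x,y)}\Bigr)\cdot\Bigl(\sup_{d_Y(f(x),f(y))\neq 0}\frac{d_X(x,y)}{d_Y(f(x),f(y))}\Bigr)$$ (suprema of nonnegative numbers, so that an empty supremum is $0$). For a finite connected graph $G$ and an edge weighting $w:E(G)\to[0,\infty)$, let $c_1(G,w)$ be the minimum of $\mathrm{dist}(f)$ over all injective maps $f$ from the shortest-path metric space of $(G,w)$ (vertices at distance $0$ being identified) to the space $\ell_1$ of absolutely summable real sequences, and let $c_1(G)=\sup_w c_1(G,w)$, the supremum over all such weightings. Let $n$ be a positive integer and let $K_{2,n}$ be the complete bipartite graph with parts of sizes $2$ and $n$. Then the minimum $c_1(K_{2,n},w)$ is attained for every weighting $w$, and $$c_1(K_{2,n})=\frac{3k-2}{2k-1},\qquad k=\left\lceil \frac n2\right\rceil .$$ -/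

import Mathlib

open scoped NNReal ENNReal

noncomputable section

namespace L1Distortion

/-- The real Banach space `ℓ₁` of absolutely summable sequences. -/
abbrev EllOne : Type := lp (fun _ : ℕ => ℝ) 1

/-- The distortion of a map `f` from a set `X` with distance function `d` to `Y`:
the largest expansion ratio times the largest contraction ratio. -/
def distortion {X Y : Type*} [PseudoEMetricSpace Y] (d : X → X → ℝ≥0∞) (f : X → Y) : ℝ≥0∞ :=
  (⨆ (x : X) (y : X) (_ : d x y ≠ 0), edist (f x) (f y) / d x y) *
    (⨆ (x : X) (y : X) (_ : edist (f x) (f y) ≠ 0), d x y / edist (f x) (f y))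

/-- `f` embeds `(X, d)` in `Y`. Here `d` may vanish at distinct points (edges of weight zero), and
the condition says that `f` comes from an injective map on the metric space obtained from `(X, d)`
by identifying points at distance zero. -/
def IsMetricEmbedding {X Y : Type*} [PseudoEMetricSpace Y] (d : X → X → ℝ≥0∞) (f : X → Y) :
    Prop :=
  ∀ x y : X, edist (f x) (f y) = 0 ↔ d x y = 0

/-- The length of a walk with respect to an edge weighting `w : E(G) → [0, ∞)`. -/
def walkLength {V : Type*} {G : SimpleGraph V} (w : G.edgeSet → ℝ≥0) :
    {u v : V} → G.Walk u v → ℝ≥0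
  | _, _, .nil => 0
  | _, _, .cons (u := a) (v := b) h p => w ⟨s(a, b), h⟩ + walkLength w p

/-- The shortest-path distance of the weighted graph `(G, w)`
(infinite between different connected components). -/
def pathDist {V : Type*} (G : SimpleGraph V) (w : G.edgeSet → ℝ≥0) (u v : V) : ℝ≥0∞ :=
  ⨅ p : G.Walk u v, (walkLength w p : ℝ≥0∞)

/-- The set of all distortions of embeddings of the shortest-path metric of `(G, w)` in `ℓ₁`. -/
def ellOneDistortions {V : Type*} (G : SimpleGraph V) (w : G.edgeSet → ℝ≥0) : Set ℝ≥0∞ :=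
  {D | ∃ f : V → EllOne,
    IsMetricEmbedding (pathDist G w) f ∧ distortion (pathDist G w) f = D}

/-- `c₁(G, w)`: the least distortion of an embedding of the shortest-path metric of `(G, w)`
in `ℓ₁`. -/
def weightedC1 {V : Type*} (G : SimpleGraph V) (w : G.edgeSet → ℝ≥0) : ℝ≥0∞ :=
  sInf (ellOneDistortions G w)

/-- `c₁(G)`: the supremum of `c₁(G, w)` over all weightings `w : E(G) → [0, ∞)`. -/
def c1 {V : Type*} (G : SimpleGraph V) : ℝ≥0∞ :=
  ⨆ w : G.edgeSet → ℝ≥0, weightedC1 G w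

end L1Distortion

end

/-!
Distances between finitely many points of `ℓ₁` are exactly the nonnegative combinations of cut
pseudometrics (`exists_cutDist_eq_dist`, `exists_dist_eq_cutDist`). This makes the problem finite
dimensional: an embedding of a finite pseudometric, scaled to be nonexpanding, becomes a vector of
cut coefficients in a compact set, on which the contraction constant attains its minimum
(`exists_isLeast_distortion`).

*Lower bound.* Take unit weights, and `2k - 1` of the `n` vertices `v i` in the part opposite to
`s, t`. Every cut, hence every `ℓ₁` distance, satisfies
`2 (k - 1)² d(s, t) + ∑ i, ∑ j, d(v i, v j) ≤ 2 (k - 1) ∑ i, (d(s, v i) + d(t, v i))`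
(`cut_inequality`): a cut separating `s` from `t` splits the `v i` into classes of sizes
`p + q = 2k - 1`, and `p q ≤ k (k - 1)`; a cut not separating them has a class of the `v i`
on the other side, whose complement has at most `2k - 2` members if the class is nonempty. The path
metric violates this inequality by the factor `(3k - 2) / (2k - 1)`.

*Upper bound.* With `D = d(s, t)`, the vertex `v i` of any weighted `K_{2,n}` hangs on a pendant
edge of length `h i` at the point with parameter `x i` of the `i`-th of `n` paths of length `D` from
`s` to `t`. Split `2k ≥ n` paths at random into two classes of size `k` and glue each class to one
arc of a circle of length `2 D`. This preserves all distances to `s` and `t`, and preserves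
`d(v i, v j) = min (x i + x j) (2 D - x i - x j)` with probability `k / (2k - 1)`, shortening it to
`|x i - x j|` otherwise. Circles embed isometrically in `ℓ₁`, by their half-circles, and therefore
so does the average. Lengthening the pendant edge at `v i` by `p * min (x i) (D - x i)`, where
`p = (k - 1) / (2k - 1)`, makes up for the loss and expands no distance by more than the factor
`1 + p = (3k - 2) / (2k - 1)` (`pendant_correction_bounds`).
-/

namespace L1Distortion

open MeasureTheory Finset
open scoped symmDiff

/-! ### The cut cone and finite subsets of `ℓ₁` -/

section CutCone

variable {V : Type*} [DecidableEq V]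

/-- The cut pseudometric of `A`: it is `1` if `A` separates `u` from `v`, and `0` otherwise. -/
def cutSep (A : Finset V) (u v : V) : ℝ := if (u ∈ A ↔ v ∈ A) then 0 else 1

lemma cutSep_nonneg (A : Finset V) (u v : V) : 0 ≤ cutSep A u v := by
  unfold cutSep; split_ifs <;> norm_num

lemma cutSep_self (A : Finset V) (u : V) : cutSep A u u = 0 := by simp [cutSep]

lemma cutSep_comm (A : Finset V) (u v : V) : cutSep A u v = cutSep A v u := by
  simp only [cutSep, iff_comm]

variable [Fintype V]

/-- The combination of cut pseudometrics with coefficients `c`. For `c ≥ 0` these are the elements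
of the cut cone. -/
def cutDist (c : Finset V → ℝ) (u v : V) : ℝ := ∑ A, c A * cutSep A u v

lemma cutDist_comm (c : Finset V → ℝ) (u v : V) : cutDist c u v = cutDist c v u := by
  simp only [cutDist, cutSep_comm _ u v]

lemma cutDist_self (c : Finset V → ℝ) (u : V) : cutDist c u u = 0 := by
  simp [cutDist, cutSep_self]

lemma cutDist_add (c c' : Finset V → ℝ) (u v : V) :
    cutDist (c + c') u v = cutDist c u v + cutDist c' u v := by
  simp [cutDist, add_mul, sum_add_distrib]

lemma cutDist_smul (a : ℝ) (c : Finset V → ℝ) (u v : V) :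
    cutDist (a • c) u v = a * cutDist c u v := by
  simp [cutDist, mul_sum, mul_assoc]

lemma cutDist_sum {ι : Type*} (s : Finset ι) (c : ι → Finset V → ℝ) (u v : V) :
    cutDist (∑ i ∈ s, c i) u v = ∑ i ∈ s, cutDist (c i) u v := by
  simp only [cutDist, Finset.sum_apply, sum_mul]
  exact sum_comm

lemma continuous_cutDist (u v : V) : Continuous fun c : Finset V → ℝ => cutDist c u v := by
  unfold cutDist; fun_prop

/-- A single coefficient is at most the distance between any two points that its cut separates. -/
lemma le_cutDist {c : Finset V → ℝ} (hc : 0 ≤ c) {A : Finset V} {u v : V} (hu : u ∈ A)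
    (hv : v ∉ A) : c A ≤ cutDist c u v := by
  have h := single_le_sum (f := fun A => c A * cutSep A u v)
    (fun B _ => mul_nonneg (hc B) (cutSep_nonneg B u v)) (mem_univ A)
  simpa [cutDist, cutSep, hu, hv] using h

/-- The distances `μ (B u ∆ B v)` between finitely many sets lie in the cut cone: the point `ω`
contributes to the cut `{v | ω ∈ B v}`. -/
lemma exists_cutDist_eq_measureReal {Ω : Type*} [MeasurableSpace Ω] (μ : Measure Ω)
    (B : V → Set Ω) (hB : ∀ v, MeasurableSet (B v)) (hfin : ∀ u v, μ (B u ∆ B v) ≠ ⊤) :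
    ∃ c : Finset V → ℝ, 0 ≤ c ∧ c ∅ = 0 ∧ c univ = 0 ∧
      ∀ u v, cutDist c u v = μ.real (B u ∆ B v) := by
  classical
  set cell : Finset V → Set Ω := fun A => {ω | univ.filter (fun v => ω ∈ B v) = A} with hcell
  have hmem : ∀ A ω, ω ∈ cell A ↔ ∀ v, ω ∈ B v ↔ v ∈ A := by
    intro A ω
    simp [hcell, Finset.ext_iff]
  have hmeas : ∀ A, MeasurableSet (cell A) := by
    intro A
    have : cell A = ⋂ v, (if v ∈ A then B v else (B v)ᶜ) := by
      ext ω
      rw [hmem, Set.mem_iInter]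
      refine forall_congr' fun v => ?_
      by_cases hv : v ∈ A <;> simp [hv]
    rw [this]
    refine MeasurableSet.iInter fun v => ?_
    split_ifs
    · exact hB v
    · exact (hB v).compl
  refine ⟨fun A => if A = ∅ ∨ A = univ then 0 else μ.real (cell A), fun A => ?_, by simp, by simp,
    fun u v => ?_⟩
  · dsimp only
    split_ifs
    · exact le_rfl
    · exact measureReal_nonneg
  have hunion : B u ∆ B v = ⋃ A ∈ univ.filter (fun A : Finset V => ¬ (u ∈ A ↔ v ∈ A)), cell A := by
    ext ω
    simp only [Set.mem_iUnion, mem_filter, mem_univ, true_and, exists_prop, Set.mem_symmDiff]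
    constructor
    · intro h
      refine ⟨univ.filter (fun v => ω ∈ B v), ?_, rfl⟩
      simp only [mem_filter, mem_univ, true_and]
      tauto
    · rintro ⟨A, hA, hω⟩
      rw [hmem] at hω
      rw [hω u, hω v]
      tauto
  have hsub : ∀ A ∈ univ.filter (fun A : Finset V => ¬ (u ∈ A ↔ v ∈ A)), μ (cell A) ≠ ⊤ := by
    intro A hA
    refine ne_top_of_le_ne_top (hfin u v) (measure_mono ?_)
    rw [hunion]
    exact Set.subset_biUnion_of_mem (u := cell) hA
  rw [hunion, measureReal_biUnion_finset _ (fun A _ => hmeas A) hsub, sum_filter]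
  · refine sum_congr rfl fun A _ => ?_
    by_cases h : u ∈ A ↔ v ∈ A
    · simp [cutSep, h]
    · have h1 : A ≠ ∅ := by rintro rfl; simp at h
      have h2 : A ≠ univ := by rintro rfl; simp at h
      simp [cutSep, h, h1, h2]
  · intro A _ A' _ hne
    refine Set.disjoint_left.2 fun ω h h' => hne ?_
    exact Eq.trans (Eq.symm h) h'

/-- Distances in `ℓ₁` are sums of the distances of the coordinates. -/
lemma ellOne_hasSum_dist (x y : EllOne) : HasSum (fun n => |x n - y n|) (dist x y) := by
  have h := lp.hasSum_norm (p := 1) (by norm_num) (x - y)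
  simpa [dist_eq_norm, Real.norm_eq_abs] using h

lemma volume_Iio_symmDiff_Iio (a b : ℝ) :
    volume (Set.Iio a ∆ Set.Iio b) = ENNReal.ofReal |a - b| := by
  have key : ∀ a b : ℝ, a ≤ b → volume (Set.Iio a ∆ Set.Iio b) = ENNReal.ofReal |a - b| := by
    intro a b hab
    have hsd : Set.Iio b \ Set.Iio a = Set.Ico a b := by ext; simp
    rw [symmDiff_of_le (Set.Iio_subset_Iio hab), hsd, Real.volume_Ico,
      abs_sub_comm, abs_of_nonneg (sub_nonneg.2 hab)]
  rcases le_total a b with h | h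
  · exact key a b h
  · rw [symmDiff_comm, abs_sub_comm]
    exact key b a h

/-- Every finite set of points of `ℓ₁` has its distances in the cut cone: cut each coordinate at
all thresholds. -/
lemma exists_cutDist_eq_dist (f : V → EllOne) :
    ∃ c : Finset V → ℝ, 0 ≤ c ∧ c ∅ = 0 ∧ c univ = 0 ∧
      ∀ u v, cutDist c u v = dist (f u) (f v) := by
  set B : V → Set (ℕ × ℝ) := fun v => {p | p.2 < f v p.1} with hBdef
  set μ : Measure (ℕ × ℝ) := (Measure.count : Measure ℕ).prod volume with hμ
  have hB : ∀ v, MeasurableSet (B v) := fun v =>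
    measurableSet_lt measurable_snd ((measurable_of_countable fun n => f v n).comp measurable_fst)
  have hval : ∀ u v, μ (B u ∆ B v) = ENNReal.ofReal (dist (f u) (f v)) := by
    intro u v
    rw [hμ, Measure.prod_apply ((hB u).symmDiff (hB v)), lintegral_count,
      ← (ellOne_hasSum_dist (f u) (f v)).tsum_eq,
      ENNReal.ofReal_tsum_of_nonneg (fun _ => abs_nonneg _) (ellOne_hasSum_dist _ _).summable]
    refine tsum_congr fun n => ?_
    rw [← volume_Iio_symmDiff_Iio]
    rfl
  obtain ⟨c, h0, h1, h2, h⟩ := exists_cutDist_eq_measureReal μ B hB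
    (fun u v => by rw [hval]; exact ENNReal.ofReal_ne_top)
  refine ⟨c, h0, h1, h2, fun u v => ?_⟩
  rw [h, measureReal_def, hval, ENNReal.toReal_ofReal dist_nonneg]

/-- Every element of the cut cone is realized by points of `ℓ₁`, one coordinate for each cut. -/
lemma exists_dist_eq_cutDist {c : Finset V → ℝ} (hc : 0 ≤ c) :
    ∃ f : V → EllOne, ∀ u v, dist (f u) (f v) = cutDist c u v := by
  set e := Fintype.equivFin (Finset V) with he
  refine ⟨fun v => ∑ A, lp.single (E := fun _ : ℕ => ℝ) 1 (e A : ℕ) (if v ∈ A then c A else 0),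
    fun u v => ?_⟩
  set x : V → EllOne :=
    fun v => ∑ A, lp.single (E := fun _ : ℕ => ℝ) 1 (e A : ℕ) (if v ∈ A then c A else 0) with hx
  have hcoord : ∀ v A, x v (e A : ℕ) = if v ∈ A then c A else 0 := by
    intro v A
    rw [hx]
    simp only [lp.coeFn_sum, Finset.sum_apply]
    rw [sum_eq_single A]
    · simp
    · intro A' _ hne
      refine lp.single_apply_ne _ _ _ fun h => hne ?_
      exact e.injective (Fin.ext h.symm)
    · simp
  have hzero : ∀ v, ∀ n ∉ Set.range (fun A => (e A : ℕ)), x v n = 0 := by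
    intro v n hn
    rw [hx]
    simp only [lp.coeFn_sum, Finset.sum_apply]
    refine sum_eq_zero fun A _ => lp.single_apply_ne _ _ _ fun h => hn ⟨A, h.symm⟩
  have hinj : Function.Injective fun A => (e A : ℕ) := fun A A' h => e.injective (Fin.ext h)
  have h := ellOne_hasSum_dist (x u) (x v)
  rw [← hinj.hasSum_iff (fun n hn => by rw [hzero u n hn, hzero v n hn]; simp)] at h
  refine (h.unique ?_ : dist (x u) (x v) = _)
  convert hasSum_fintype _ using 1
  refine sum_congr rfl fun A _ => ?_
  have hA : 0 ≤ c A := hc A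
  simp only [Function.comp, hcoord, cutSep]
  by_cases hu : u ∈ A <;> by_cases hv : v ∈ A <;> simp [hu, hv, abs_of_nonneg hA]

end CutCone

/-! ### Distortion in terms of real constants -/

section Distortion

variable {V Y : Type*} [PseudoMetricSpace Y] {d : V → V → ℝ≥0∞} {f : V → Y}

lemma isMetricEmbedding_of_le (hd : ∀ u v, d u v ≠ ⊤) {E C : ℝ}
    (hE : ∀ u v, dist (f u) (f v) ≤ E * (d u v).toReal)
    (hC : ∀ u v, (d u v).toReal ≤ C * dist (f u) (f v)) : IsMetricEmbedding d f := by
  intro u v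
  rw [edist_dist, ENNReal.ofReal_eq_zero]
  constructor
  · intro h
    have h0 : dist (f u) (f v) = 0 := le_antisymm h dist_nonneg
    have h1 := hC u v
    rw [h0, mul_zero] at h1
    exact ((ENNReal.toReal_eq_zero_iff _).1 (le_antisymm h1 ENNReal.toReal_nonneg)).resolve_right
      (hd u v)
  · intro h
    simpa [h] using hE u v

lemma distortion_le_of_le (hd : ∀ u v, d u v ≠ ⊤) {E C : ℝ} (hE0 : 0 ≤ E)
    (hE : ∀ u v, dist (f u) (f v) ≤ E * (d u v).toReal)
    (hC : ∀ u v, (d u v).toReal ≤ C * dist (f u) (f v)) :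
    distortion d f ≤ ENNReal.ofReal (E * C) := by
  rw [distortion, ENNReal.ofReal_mul hE0]
  refine mul_le_mul' (iSup_le fun u => iSup_le fun v => iSup_le fun h => ?_)
    (iSup_le fun u => iSup_le fun v => iSup_le fun h => ?_)
  · rw [ENNReal.div_le_iff h (hd u v), edist_dist]
    conv_rhs => rw [← ENNReal.ofReal_toReal (hd u v)]
    rw [← ENNReal.ofReal_mul hE0]
    exact ENNReal.ofReal_le_ofReal (hE u v)
  · rw [ENNReal.div_le_iff h (edist_ne_top _ _), edist_dist,
      ← ENNReal.ofReal_mul' dist_nonneg]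
    conv_lhs => rw [← ENNReal.ofReal_toReal (hd u v)]
    exact ENNReal.ofReal_le_ofReal (hC u v)

/-- A finite distortion is the product of an expansion and a contraction constant. Only the product
is assumed finite; since a pair at positive distance exists, neither factor vanishes, so both are
finite. -/
lemma exists_expansion_contraction (hd : ∀ u v, d u v ≠ ⊤) (hne : ∃ u v, d u v ≠ 0)
    (hf : IsMetricEmbedding d f) (htop : distortion d f ≠ ⊤) :
    ∃ E C : ℝ, 0 < E ∧ 0 < C ∧ distortion d f = ENNReal.ofReal (E * C) ∧
      (∀ u v, dist (f u) (f v) ≤ E * (d u v).toReal) ∧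
      ∀ u v, (d u v).toReal ≤ C * dist (f u) (f v) := by
  set E := ⨆ (x : V) (y : V) (_ : d x y ≠ 0), edist (f x) (f y) / d x y with hE
  set C := ⨆ (x : V) (y : V) (_ : edist (f x) (f y) ≠ 0), d x y / edist (f x) (f y) with hC
  have hD : distortion d f = E * C := rfl
  have hEle : ∀ u v, edist (f u) (f v) ≤ E * d u v := by
    intro u v
    by_cases h : d u v = 0
    · rw [(hf u v).2 h]; exact zero_le
    · rw [← ENNReal.div_le_iff h (hd u v)]
      exact le_iSup_of_le u (le_iSup_of_le v (le_iSup_of_le h le_rfl))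
  have hCle : ∀ u v, d u v ≤ C * edist (f u) (f v) := by
    intro u v
    by_cases h : edist (f u) (f v) = 0
    · rw [(hf u v).1 h]; exact zero_le
    · rw [← ENNReal.div_le_iff h (edist_ne_top _ _)]
      exact le_iSup_of_le u (le_iSup_of_le v (le_iSup_of_le h le_rfl))
  obtain ⟨u, v, huv⟩ := hne
  have hE0 : E ≠ 0 := by
    intro h
    have := hEle u v
    rw [h, zero_mul] at this
    exact huv ((hf u v).1 (le_antisymm this zero_le))
  have hC0 : C ≠ 0 := by
    intro h
    have := hCle u v
    rw [h, zero_mul] at this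
    exact huv (le_antisymm this zero_le)
  rw [hD] at htop
  have hEt : E ≠ ⊤ := fun h => htop (by rw [h, ENNReal.top_mul hC0])
  have hCt : C ≠ ⊤ := fun h => htop (by rw [h, ENNReal.mul_top hE0])
  refine ⟨E.toReal, C.toReal, ENNReal.toReal_pos hE0 hEt, ENNReal.toReal_pos hC0 hCt, ?_,
    fun u v => ?_, fun u v => ?_⟩
  · rw [hD, ← ENNReal.toReal_mul, ENNReal.ofReal_toReal htop]
  · rw [← ENNReal.toReal_mul, dist_edist]
    exact ENNReal.toReal_mono (ENNReal.mul_ne_top hEt (hd u v)) (hEle u v)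
  · rw [dist_edist, ← ENNReal.toReal_mul]
    exact ENNReal.toReal_mono (ENNReal.mul_ne_top hCt (edist_ne_top _ _)) (hCle u v)

end Distortion

/-! ### The least distortion is attained -/

section Attainment

variable {V : Type*} [Fintype V] [DecidableEq V]

/-- Among the elements of the cut cone below `δ`, one approximates `δ` best, provided that some
element approximates `δ` up to a constant. -/
lemma exists_min_contraction {δ : V → V → ℝ}
    (h0 : ∃ c : Finset V → ℝ, ∃ C : ℝ, 0 ≤ C ∧ 0 ≤ c ∧ c ∅ = 0 ∧ c univ = 0 ∧
      (∀ u v, cutDist c u v ≤ δ u v) ∧ ∀ u v, δ u v ≤ C * cutDist c u v) :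
    ∃ c : Finset V → ℝ, ∃ C : ℝ, 0 ≤ C ∧ 0 ≤ c ∧
      (∀ u v, cutDist c u v ≤ δ u v) ∧ (∀ u v, δ u v ≤ C * cutDist c u v) ∧
      ∀ c' : Finset V → ℝ, ∀ C' : ℝ, 0 ≤ C' → 0 ≤ c' → c' ∅ = 0 → c' univ = 0 →
        (∀ u v, cutDist c' u v ≤ δ u v) → (∀ u v, δ u v ≤ C' * cutDist c' u v) → C ≤ C' := by
  obtain ⟨c₀, C₀, hC₀, hc₀, he₀, hu₀, hle₀, hge₀⟩ := h0
  set K : Set ((Finset V → ℝ) × ℝ) := {p | 0 ≤ p.2 ∧ p.2 ≤ C₀ ∧ 0 ≤ p.1 ∧ p.1 ∅ = 0 ∧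
    p.1 univ = 0 ∧ (∀ u v, cutDist p.1 u v ≤ δ u v) ∧ ∀ u v, δ u v ≤ p.2 * cutDist p.1 u v}
    with hK
  have hcont : ∀ u v : V, Continuous fun p : (Finset V → ℝ) × ℝ => cutDist p.1 u v :=
    fun u v => (continuous_cutDist u v).comp continuous_fst
  have hclosed : IsClosed K := by
    have hap : ∀ A : Finset V, Continuous fun p : (Finset V → ℝ) × ℝ => p.1 A := fun A => by
      fun_prop
    refine (isClosed_le continuous_const continuous_snd).and <|
      (isClosed_le continuous_snd continuous_const).and <|
      (isClosed_le continuous_const continuous_fst).and <|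
      (isClosed_eq (hap _) continuous_const).and <|
      (isClosed_eq (hap _) continuous_const).and <| IsClosed.and ?_ ?_
    · simp only [Set.ofPred_forall]
      exact isClosed_iInter fun u => isClosed_iInter fun v =>
        isClosed_le (hcont u v) continuous_const
    · simp only [Set.ofPred_forall]
      exact isClosed_iInter fun u => isClosed_iInter fun v =>
        isClosed_le continuous_const (continuous_snd.mul (hcont u v))
  -- A cut other than `∅` and `univ` separates some pair, which bounds its coefficient.
  have hsub : K ⊆ Set.Icc (0, 0) (fun _ => ∑ u, ∑ v, |δ u v|, C₀) := by
    rintro ⟨c, C⟩ ⟨h1, h2, h3, h4, h5, h6, -⟩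
    dsimp only at h1 h2 h3 h4 h5 h6
    refine ⟨⟨h3, h1⟩, ⟨fun A => ?_, h2⟩⟩
    have hnn : (0 : ℝ) ≤ ∑ u, ∑ v, |δ u v| :=
      sum_nonneg fun _ _ => sum_nonneg fun _ _ => abs_nonneg _
    by_cases hA : A = ∅
    · simpa [hA, h4] using hnn
    by_cases hA' : A = univ
    · simpa [hA', h5] using hnn
    obtain ⟨u, hu⟩ := nonempty_iff_ne_empty.2 hA
    obtain ⟨v, hv⟩ : ∃ v, v ∉ A := by
      by_contra! h
      exact hA' (eq_univ_iff_forall.2 h)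
    calc c A ≤ cutDist c u v := le_cutDist h3 hu hv
      _ ≤ |δ u v| := (h6 u v).trans (le_abs_self _)
      _ ≤ ∑ v, |δ u v| := single_le_sum (f := fun v => |δ u v|) (fun _ _ => abs_nonneg _)
          (mem_univ v)
      _ ≤ ∑ u, ∑ v, |δ u v| := single_le_sum (f := fun u => ∑ v, |δ u v|)
          (fun _ _ => sum_nonneg fun _ _ => abs_nonneg _) (mem_univ u)
  have hcpt : IsCompact K := isCompact_Icc.of_isClosed_subset hclosed hsub
  obtain ⟨⟨c, C⟩, ⟨h1, h2, h3, h4, h5, h6, h7⟩, hmin⟩ := hcpt.exists_isMinOn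
    ⟨(c₀, C₀), hC₀, le_rfl, hc₀, he₀, hu₀, hle₀, hge₀⟩ continuous_snd.continuousOn
  refine ⟨c, C, h1, h3, h6, h7, fun c' C' h1' h3' h4' h5' h6' h7' => ?_⟩
  rcases le_total C' C₀ with h | h
  · exact hmin (show ((c', C') : (Finset V → ℝ) × ℝ) ∈ K from ⟨h1', h, h3', h4', h5', h6', h7'⟩)
  · exact h2.trans h

/-- Scaling an embedding of finite distortion to be nonexpanding turns it into an element of the
cut cone whose contraction constant is the distortion. -/
lemma exists_cutDist_of_embedding {d : V → V → ℝ≥0∞} (hd : ∀ u v, d u v ≠ ⊤)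
    (hne : ∃ u v, d u v ≠ 0) {f : V → EllOne} (hf : IsMetricEmbedding d f)
    (htop : distortion d f ≠ ⊤) :
    ∃ c : Finset V → ℝ, ∃ C : ℝ, 0 ≤ C ∧ distortion d f = ENNReal.ofReal C ∧ 0 ≤ c ∧ c ∅ = 0 ∧
      c univ = 0 ∧ (∀ u v, cutDist c u v ≤ (d u v).toReal) ∧
      ∀ u v, (d u v).toReal ≤ C * cutDist c u v := by
  obtain ⟨E, C, hE0, hC0, hD, hE, hC⟩ := exists_expansion_contraction hd hne hf htop
  obtain ⟨c, hc0, hc1, hc2, hc⟩ := exists_cutDist_eq_dist f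
  refine ⟨E⁻¹ • c, E * C, by positivity, hD, ?_, by simp [hc1], by simp [hc2], fun u v => ?_,
    fun u v => ?_⟩
  · exact smul_nonneg (by positivity) hc0
  · rw [cutDist_smul, hc, inv_mul_le_iff₀ hE0]
    exact hE u v
  · rw [cutDist_smul, hc]
    convert hC u v using 1
    field_simp

/-- The least distortion in `ℓ₁` of a finite pseudometric is attained, as soon as some embedding
has finite distortion. -/
lemma exists_isLeast_distortion {d : V → V → ℝ≥0∞} (hd : ∀ u v, d u v ≠ ⊤)
    (hex : ∃ f : V → EllOne, IsMetricEmbedding d f ∧ distortion d f ≠ ⊤) :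
    ∃ D, IsLeast {D | ∃ f : V → EllOne, IsMetricEmbedding d f ∧ distortion d f = D} D := by
  obtain ⟨f₀, hf₀, htop₀⟩ := hex
  by_cases hne : ∃ u v, d u v ≠ 0
  · obtain ⟨c₀, C₀, hC₀, -, h₀⟩ := exists_cutDist_of_embedding hd hne hf₀ htop₀
    obtain ⟨c, C, hC, hc, hle, hge, hmin⟩ := exists_min_contraction ⟨c₀, C₀, hC₀, h₀⟩
    obtain ⟨f, hf⟩ := exists_dist_eq_cutDist hc
    have hE1 : ∀ u v, dist (f u) (f v) ≤ 1 * (d u v).toReal := fun u v => by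
      rw [hf, one_mul]; exact hle u v
    have hC1 : ∀ u v, (d u v).toReal ≤ C * dist (f u) (f v) := fun u v => by
      rw [hf]; exact hge u v
    have hlower : ∀ g : V → EllOne, IsMetricEmbedding d g → ENNReal.ofReal C ≤ distortion d g := by
      intro g hg
      by_cases htop : distortion d g = ⊤
      · rw [htop]; exact le_top
      obtain ⟨c', C', hC', hD', h3, h4, h5, h6, h7⟩ := exists_cutDist_of_embedding hd hne hg htop
      rw [hD']
      exact ENNReal.ofReal_le_ofReal (hmin c' C' hC' h3 h4 h5 h6 h7)
    have hemb := isMetricEmbedding_of_le hd hE1 hC1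
    refine ⟨ENNReal.ofReal C, ⟨f, hemb, le_antisymm ?_ (hlower f hemb)⟩, ?_⟩
    · simpa using distortion_le_of_le hd zero_le_one hE1 hC1
    · rintro _ ⟨g, hg, rfl⟩
      exact hlower g hg
  · -- All distances vanish: both suprema are empty and the distortion is `0`.
    push Not at hne
    refine ⟨0, ⟨f₀, hf₀, ?_⟩, fun _ _ => zero_le⟩
    simp [distortion, hne]

end Attainment

/-! ### Shortest-path distances -/

section PathDist

variable {V : Type*} {G : SimpleGraph V} (w : G.edgeSet → ℝ≥0)

lemma walkLength_append {u v x : V} (p : G.Walk u v) (q : G.Walk v x) :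
    walkLength w (p.append q) = walkLength w p + walkLength w q := by
  induction p with
  | nil => simp [walkLength]
  | cons h p ih => simp [walkLength, ih, add_assoc]

lemma walkLength_reverse {u v : V} (p : G.Walk u v) :
    walkLength w p.reverse = walkLength w p := by
  induction p with
  | nil => rfl
  | @cons a b c h p ih =>
    rw [SimpleGraph.Walk.reverse_cons, walkLength_append, ih]
    simp only [walkLength, add_zero]
    rw [add_comm]
    congr 2
    exact Subtype.ext Sym2.eq_swap

lemma walkLength_one {u v : V} (p : G.Walk u v) : walkLength (fun _ => 1) p = p.length := by
  induction p with
  | nil => simp [walkLength]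
  | cons h p ih => simp [walkLength, ih, add_comm]

lemma pathDist_self (u : V) : pathDist G w u u = 0 :=
  le_antisymm (iInf_le_of_le .nil (by simp [walkLength])) zero_le

lemma pathDist_comm (u v : V) : pathDist G w u v = pathDist G w v u := by
  have key : ∀ u v, pathDist G w u v ≤ pathDist G w v u := fun u v =>
    le_iInf fun p => iInf_le_of_le p.reverse (by rw [walkLength_reverse])
  exact le_antisymm (key u v) (key v u)

lemma pathDist_triangle (u v x : V) :
    pathDist G w u x ≤ pathDist G w u v + pathDist G w v x := by
  refine ENNReal.le_iInf_add_iInf fun p q => iInf_le_of_le (p.append q) ?_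
  rw [walkLength_append, ENNReal.coe_add]

lemma pathDist_le_of_adj {u v : V} (h : G.Adj u v) : pathDist G w u v ≤ w ⟨s(u, v), h⟩ :=
  iInf_le_of_le (.cons h .nil) (by simp [walkLength])

lemma pathDist_ne_top (hG : G.Connected) (u v : V) : pathDist G w u v ≠ ⊤ := by
  obtain ⟨p⟩ := hG.preconnected u v
  exact ne_top_of_le_ne_top ENNReal.coe_ne_top (iInf_le _ p)

/-- With unit weights, distinct nonadjacent vertices are at distance at least `2`. -/
lemma two_le_pathDist_one {u v : V} (hne : u ≠ v) (hadj : ¬ G.Adj u v) :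
    2 ≤ pathDist G (fun _ => 1) u v := by
  refine le_iInf fun p => ?_
  rw [walkLength_one]
  have : 2 ≤ p.length := by
    cases p with
    | nil => exact absurd rfl hne
    | cons h p =>
      cases p with
      | nil => exact absurd h hadj
      | cons h' p => simp
  exact_mod_cast this

end PathDist

/-! ### The graph `K_{2,n}` -/

section CompleteBipartite

variable {n : ℕ}

/-- The graph `K_{2,n}`. -/
abbrev K2 (n : ℕ) : SimpleGraph (Fin 2 ⊕ Fin n) := completeBipartiteGraph (Fin 2) (Fin n)

lemma K2_adj (a : Fin 2) (i : Fin n) : (K2 n).Adj (.inl a) (.inr i) := by simp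

lemma K2_connected (hn : 0 < n) : (K2 n).Connected := by
  have : Nonempty (Fin n) := ⟨⟨0, hn⟩⟩
  have : ∀ a : Fin 2, ∀ v, (K2 n).Reachable (.inl a) v := by
    rintro a (b | i)
    · exact (K2_adj a ⟨0, hn⟩).reachable.trans (K2_adj b ⟨0, hn⟩).symm.reachable
    · exact (K2_adj a i).reachable
  exact { preconnected := fun u v => (this 0 u).symm.trans (this 0 v), nonempty := inferInstance }

/-- A shortest path between two vertices of the part of size `n` starts through one of the two
vertices of the other part. -/
lemma pathDist_inr_inr (w : (K2 n).edgeSet → ℝ≥0) {i j : Fin n} (hij : i ≠ j) :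
    pathDist (K2 n) w (.inr i) (.inr j) =
      min (pathDist (K2 n) w (.inl 0) (.inr i) + pathDist (K2 n) w (.inl 0) (.inr j))
        (pathDist (K2 n) w (.inl 1) (.inr i) + pathDist (K2 n) w (.inl 1) (.inr j)) := by
  refine le_antisymm (le_min ?_ ?_) (le_iInf fun p => ?_)
  · rw [pathDist_comm w (.inl 0) (.inr i)]
    exact pathDist_triangle w _ _ _
  · rw [pathDist_comm w (.inl 1) (.inr i)]
    exact pathDist_triangle w _ _ _
  · cases p with
    | nil => exact absurd rfl hij
    | @cons _ b _ h p =>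
      rcases b with a | b
      · have key : pathDist (K2 n) w (.inl a) (.inr i) + pathDist (K2 n) w (.inl a) (.inr j) ≤
            (walkLength w (SimpleGraph.Walk.cons h p) : ℝ≥0) := by
          rw [walkLength, ENNReal.coe_add]
          refine add_le_add ?_ (iInf_le _ p)
          rw [pathDist_comm]
          exact pathDist_le_of_adj w h
        fin_cases a
        · exact (min_le_left _ _).trans key
        · exact (min_le_right _ _).trans key
      · simp at h

end CompleteBipartite

/-! ### The lower bound -/

section LowerBound

/-- The Poincaré-type inequality behind the lower bound, for a single cut. It is an equality when
the cut separates `s` from `t` and splits the `2k - 1` points `x i` as evenly as possible. -/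
lemma cut_inequality {V : Type*} [DecidableEq V] (A : Finset V) (s t : V) {k : ℕ} (hk : 1 ≤ k)
    (x : Fin (2 * k - 1) → V) :
    2 * ((k : ℝ) - 1) ^ 2 * cutSep A s t + ∑ i, ∑ j, cutSep A (x i) (x j) ≤
      2 * ((k : ℝ) - 1) * ∑ i, (cutSep A s (x i) + cutSep A t (x i)) := by
  classical
  set P := univ.filter (fun i => x i ∈ A) with hP
  set Q := univ.filter (fun i => x i ∉ A) with hQ
  have hPQ : P.card + Q.card = 2 * k - 1 := by
    rw [hP, hQ, card_filter_add_card_filter_not, card_univ, Fintype.card_fin]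
  have hsep : ∀ u, ∑ i, cutSep A u (x i) = if u ∈ A then (Q.card : ℝ) else P.card := by
    intro u
    by_cases hu : u ∈ A <;> simp [cutSep, hu, hP, hQ, Finset.sum_ite]
  have hpair : ∑ i, ∑ j, cutSep A (x i) (x j) = 2 * (P.card : ℝ) * Q.card := by
    simp_rw [hsep]
    rw [sum_ite, sum_const, sum_const, ← hP, ← hQ]
    simp only [nsmul_eq_mul]
    ring
  rw [hpair, sum_add_distrib, hsep, hsep]
  obtain ⟨m, rfl⟩ : ∃ m, k = m + 1 := ⟨k - 1, by omega⟩
  have hPQ' : (Q.card : ℝ) = 2 * m + 1 - P.card := by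
    have : P.card + Q.card = 2 * m + 1 := by omega
    rw [eq_sub_iff_add_eq, add_comm]
    exact_mod_cast this
  generalize P.card = p at *
  generalize Q.card = q at *
  have hp0 : (0 : ℝ) ≤ p := p.cast_nonneg
  have hm0 : (0 : ℝ) ≤ m := m.cast_nonneg
  -- `p (2m + 1 - p) ≤ m (m + 1)` because no integer lies strictly between `m` and `m + 1`.
  have hint : (0 : ℝ) ≤ ((p : ℝ) - m) * (p - m - 1) := by
    rcases le_or_gt p m with h | h
    · have : (p : ℝ) ≤ m := by exact_mod_cast h
      nlinarith
    · have : (m : ℝ) + 1 ≤ p := by exact_mod_cast h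
      nlinarith
  -- If a class is nonempty, the other has at most `2m` elements.
  have hside : ∀ p q : ℕ, (q : ℝ) = 2 * m + 1 - p → (p : ℝ) * q ≤ 2 * m * p := by
    intro p q h
    rcases Nat.eq_zero_or_pos p with rfl | hp
    · simp
    · have : (1 : ℝ) ≤ p := by exact_mod_cast hp
      nlinarith
  have h1 := hside p q hPQ'
  have h2 := hside q p (by rw [hPQ']; ring)
  push_cast
  by_cases hs : s ∈ A <;> by_cases ht : t ∈ A <;>
    simp only [cutSep, hs, ht, if_true, if_false, iff_true, iff_false, not_true]
  · nlinarith
  · rw [hPQ']; nlinarith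
  · rw [hPQ']; nlinarith
  · nlinarith

/-- Summed over cuts, the inequality holds for all distances in `ℓ₁`. -/
lemma cutDist_inequality {V : Type*} [Fintype V] [DecidableEq V] {c : Finset V → ℝ} (hc : 0 ≤ c)
    (s t : V) {k : ℕ} (hk : 1 ≤ k) (x : Fin (2 * k - 1) → V) :
    2 * ((k : ℝ) - 1) ^ 2 * cutDist c s t + ∑ i, ∑ j, cutDist c (x i) (x j) ≤
      2 * ((k : ℝ) - 1) * ∑ i, (cutDist c s (x i) + cutDist c t (x i)) := by
  have h := sum_le_sum fun (A : Finset V) (_ : A ∈ univ) =>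
    mul_le_mul_of_nonneg_left (cut_inequality A s t hk x) (hc A)
  have hpair : ∑ i, ∑ j, cutDist c (x i) (x j) =
      ∑ A, c A * ∑ i, ∑ j, cutSep A (x i) (x j) := by
    simp only [cutDist, mul_sum]
    exact (sum_congr rfl fun i _ => sum_comm).trans sum_comm
  have hsum : ∑ i, (cutDist c s (x i) + cutDist c t (x i)) =
      ∑ A, c A * ∑ i, (cutSep A s (x i) + cutSep A t (x i)) := by
    simp only [cutDist, mul_sum, ← sum_add_distrib, ← mul_add]
    exact sum_comm
  rw [hpair, hsum, cutDist, mul_sum, mul_sum, ← sum_add_distrib]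
  refine le_trans (le_of_eq (sum_congr rfl fun A _ => ?_))
    (h.trans (le_of_eq (sum_congr rfl fun A _ => ?_))) <;> ring

/-- The unit weighting of `K_{2,n}` has distortion at least `(3k - 2) / (2k - 1)`. -/
lemma le_distortion_one {n k : ℕ} (hk : 1 ≤ k) (hkn : 2 * k - 1 ≤ n)
    {f : Fin 2 ⊕ Fin n → EllOne} (hf : IsMetricEmbedding (pathDist (K2 n) fun _ => 1) f) :
    ENNReal.ofReal ((3 * (k : ℝ) - 2) / (2 * k - 1)) ≤
      distortion (pathDist (K2 n) fun _ => 1) f := by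
  set d := pathDist (K2 n) fun _ => 1 with hdef
  have hn : 0 < n := by omega
  have hd : ∀ u v, d u v ≠ ⊤ := pathDist_ne_top _ (K2_connected hn)
  have hst : 2 ≤ d (.inl 0) (.inl 1) := two_le_pathDist_one (by simp) (by simp)
  have hvv : ∀ i j : Fin n, i ≠ j → 2 ≤ d (.inr i) (.inr j) := fun i j hij =>
    two_le_pathDist_one (by simpa using hij) (by simp)
  have hsv : ∀ (a : Fin 2) (i : Fin n), d (.inl a) (.inr i) ≤ 1 := fun a i =>
    (pathDist_le_of_adj _ (K2_adj a i)).trans (by simp)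
  by_cases htop : distortion d f = ⊤
  · rw [htop]; exact le_top
  have hne : ∃ u v, d u v ≠ 0 := ⟨_, _, fun h => by rw [h] at hst; simp at hst⟩
  obtain ⟨c, C, hC0, hD, hc, -, -, hle, hge⟩ := exists_cutDist_of_embedding hd hne hf htop
  rw [hD]
  refine ENNReal.ofReal_le_ofReal ?_
  have hst' : 2 ≤ C * cutDist c (.inl 0) (.inl 1) := by
    refine le_trans ?_ (hge _ _)
    exact (ENNReal.ofReal_le_iff_le_toReal (hd _ _)).1 (by simpa using hst)
  have hvv' : ∀ i j : Fin n, i ≠ j → 2 ≤ C * cutDist c (.inr i) (.inr j) := by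
    intro i j hij
    refine le_trans ?_ (hge _ _)
    exact (ENNReal.ofReal_le_iff_le_toReal (hd _ _)).1 (by simpa using hvv i j hij)
  have hsv' : ∀ (a : Fin 2) (i : Fin n), cutDist c (.inl a) (.inr i) ≤ 1 := fun a i =>
    (hle _ _).trans (ENNReal.toReal_le_of_le_ofReal zero_le_one (by simpa using hsv a i))
  have hk1 : (1 : ℝ) ≤ k := by exact_mod_cast hk
  rw [div_le_iff₀ (by linarith)]
  rcases hk.eq_or_lt with rfl | hk2
  · -- The inequality degenerates for `k = 1`, but every distortion is at least `1`.
    have h1 : cutDist c (.inl (0 : Fin 2)) (.inl 1) ≤ (d (.inl 0) (.inl 1)).toReal := hle _ _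
    have h2 : (d (.inl 0) (.inl 1)).toReal ≤ C * cutDist c (.inl 0) (.inl 1) := hge _ _
    have h3 : (2 : ℝ) ≤ (d (.inl 0) (.inl 1)).toReal :=
      (ENNReal.ofReal_le_iff_le_toReal (hd _ _)).1 (by simpa using hst)
    push_cast
    by_contra! hlt
    nlinarith
  have hk2' : (0 : ℝ) < k - 1 := by
    have : (1 : ℝ) < k := by exact_mod_cast hk2
    linarith
  have hmain := mul_le_mul_of_nonneg_left
    (cutDist_inequality hc (.inl 0) (.inl 1) hk fun i => .inr (Fin.castLE hkn i)) hC0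
  have hcard : ((2 * k - 1 : ℕ) : ℝ) = 2 * k - 1 := by
    rw [Nat.cast_sub (by omega)]; push_cast; ring
  have hpairs : (2 * (k : ℝ) - 1) * (4 * (k - 1)) ≤ C * ∑ i : Fin (2 * k - 1), ∑ j,
      cutDist c (.inr (Fin.castLE hkn i)) (.inr (Fin.castLE hkn j)) := by
    rw [mul_sum]
    have : ∀ i : Fin (2 * k - 1), 4 * ((k : ℝ) - 1) ≤ C * ∑ j : Fin (2 * k - 1),
        cutDist c (.inr (Fin.castLE hkn i)) (.inr (Fin.castLE hkn j)) := by
      intro i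
      rw [mul_sum, ← add_sum_erase _ _ (mem_univ i), cutDist_self, mul_zero, zero_add]
      have := card_nsmul_le_sum (univ.erase i) (fun j : Fin (2 * k - 1) =>
        C * cutDist c (.inr (Fin.castLE hkn i)) (.inr (Fin.castLE hkn j))) 2 (fun j hj =>
          hvv' _ _ fun h => (ne_of_mem_erase hj) (Fin.castLE_injective hkn h).symm)
      refine le_trans (le_of_eq ?_) this
      rw [card_erase_of_mem (mem_univ i), card_univ, Fintype.card_fin, nsmul_eq_mul,
        Nat.cast_sub (by omega), hcard]
      push_cast; ring
    have := card_nsmul_le_sum univ _ _ fun i (_ : i ∈ univ) => this i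
    rwa [card_univ, Fintype.card_fin, nsmul_eq_mul, hcard] at this
  have hedges : ∑ i : Fin (2 * k - 1), (cutDist c (.inl (0 : Fin 2)) (.inr (Fin.castLE hkn i)) +
      cutDist c (.inl (1 : Fin 2)) (.inr (Fin.castLE hkn i))) ≤ (2 * k - 1) * 2 := by
    have := sum_le_card_nsmul univ _ (2 : ℝ) fun (i : Fin (2 * k - 1)) (_ : i ∈ univ) =>
      show cutDist c (.inl (0 : Fin 2)) (.inr (Fin.castLE hkn i)) +
        cutDist c (.inl (1 : Fin 2)) (.inr (Fin.castLE hkn i)) ≤ 2 by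
          linarith [hsv' 0 (Fin.castLE hkn i), hsv' 1 (Fin.castLE hkn i)]
    rwa [card_univ, Fintype.card_fin, nsmul_eq_mul, hcard] at this
  have h1 := mul_le_mul_of_nonneg_left hst' (show (0 : ℝ) ≤ 2 * (k - 1) ^ 2 by positivity)
  have h2 := mul_le_mul_of_nonneg_left hedges (show (0 : ℝ) ≤ C * (2 * (k - 1)) by positivity)
  have h3 : 4 * ((k : ℝ) - 1) * (3 * k - 2) ≤ 4 * (k - 1) * (C * (2 * k - 1)) := by
    nlinarith
  exact le_of_mul_le_mul_left h3 (by linarith)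

end LowerBound

/-! ### The upper bound -/

section UpperBound

lemma volumeReal_Ioc_symmDiff_Ioc (a b c e : ℝ) :
    volume.real (Set.Ioc a b ∆ Set.Ioc c e) =
      max (b - a) 0 + max (e - c) 0 - 2 * max (min b e - max a c) 0 := by
  have h1 := measureReal_inter_add_sdiff (μ := volume) (s := Set.Ioc a b)
    (measurableSet_Ioc (a := c) (b := e)) measure_Ioc_lt_top.ne
  have h2 := measureReal_inter_add_sdiff (μ := volume) (s := Set.Ioc c e)
    (measurableSet_Ioc (a := a) (b := b)) measure_Ioc_lt_top.ne
  rw [Set.inter_comm] at h2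
  have h3 := measureReal_symmDiff_eq (μ := volume) (measurableSet_Ioc (a := a) (b := b))
    (measurableSet_Ioc (a := c) (b := e)) measure_Ioc_lt_top.ne
    measure_Ioc_lt_top.ne
  rw [Set.Ioc_inter_Ioc] at h1 h2
  simp only [Real.volume_real_Ioc] at h1 h2
  rw [h3]
  linarith

lemma volumeReal_initial_symmDiff_initial {x y : ℝ} (hx : 0 ≤ x) (hy : 0 ≤ y) :
    volume.real (Set.Ioc 0 x ∆ Set.Ioc 0 y) = |x - y| := by
  rw [volumeReal_Ioc_symmDiff_Ioc]
  rcases le_total x y with h | h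
  · rw [abs_of_nonpos (by linarith)]
    simp [hx, hy, h]; ring
  · rw [abs_of_nonneg (by linarith)]
    simp [hx, hy, h]; ring

lemma volumeReal_final_symmDiff_final {D x y : ℝ} (hx : 0 ≤ x) (hy : 0 ≤ y) :
    volume.real (Set.Ioc (D - x) D ∆ Set.Ioc (D - y) D) = |x - y| := by
  rw [volumeReal_Ioc_symmDiff_Ioc]
  rcases le_total x y with h | h
  · rw [abs_of_nonpos (by linarith), max_eq_left (sub_le_sub_left h D)]
    simp [hx, hy]; ring
  · rw [abs_of_nonneg (by linarith), max_eq_right (sub_le_sub_left h D)]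
    simp [hx, hy]; ring

/-- Points at distance `x` and `y` from `0` on the two arcs of a circle of length `2 D`: their
distance is the measure of the set of half-circles separating them. -/
lemma volumeReal_initial_symmDiff_final {D x y : ℝ} (hx : 0 ≤ x) (hxD : x ≤ D) (hy : 0 ≤ y)
    (hyD : y ≤ D) :
    volume.real (Set.Ioc 0 x ∆ Set.Ioc (D - y) D) = min (x + y) (2 * D - x - y) := by
  rw [volumeReal_Ioc_symmDiff_Ioc, min_eq_left hxD, max_eq_right (show 0 ≤ D - y by linarith),
    max_eq_left (show 0 ≤ x - 0 by linarith), max_eq_left (show 0 ≤ D - (D - y) by linarith)]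
  rcases le_total (x + y) D with h | h
  · rw [max_eq_right (by linarith), min_eq_left (by linarith)]; ring
  · rw [max_eq_left (by linarith), min_eq_right (by linarith)]; ring

/-- The circle of length `2 D` lies in the cut cone: here the two vertices `inl 0`, `inl 1` are
antipodal, and `inr i` is placed at distance `x i` from `inl 0` on one of the two arcs joining them,
chosen by `P`. -/
lemma exists_circle_cutDist {n : ℕ} {D : ℝ} (hD : 0 ≤ D) (x : Fin n → ℝ) (hx : ∀ i, 0 ≤ x i)
    (hxD : ∀ i, x i ≤ D) (P : Fin n → Prop) [DecidablePred P] :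
    ∃ c : Finset (Fin 2 ⊕ Fin n) → ℝ, 0 ≤ c ∧ cutDist c (.inl 0) (.inl 1) = D ∧
      (∀ i, cutDist c (.inl 0) (.inr i) = x i) ∧ (∀ i, cutDist c (.inl 1) (.inr i) = D - x i) ∧
      ∀ i j, cutDist c (.inr i) (.inr j) =
        if P i ↔ P j then |x i - x j| else min (x i + x j) (2 * D - x i - x j) := by
  set B : Fin 2 ⊕ Fin n → Set ℝ := Sum.elim ![Set.Ioc 0 0, Set.Ioc 0 D]
    (fun i => if P i then Set.Ioc 0 (x i) else Set.Ioc (D - x i) D) with hB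
  have hIoc : ∀ v, ∃ a b, B v = Set.Ioc a b := by
    rintro (a | i)
    · fin_cases a
      · exact ⟨0, 0, rfl⟩
      · exact ⟨0, D, rfl⟩
    · by_cases h : P i
      · exact ⟨0, x i, by simp [hB, h]⟩
      · exact ⟨D - x i, D, by simp [hB, h]⟩
  obtain ⟨c, hc, -, -, h⟩ := exists_cutDist_eq_measureReal volume B
    (fun v => by obtain ⟨a, b, h⟩ := hIoc v; rw [h]; exact measurableSet_Ioc)
    (fun u v => by
      obtain ⟨a, b, h⟩ := hIoc u
      obtain ⟨a', b', h'⟩ := hIoc v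
      rw [h, h']
      refine ne_top_of_le_ne_top ?_ (measure_mono (Set.symmDiff_subset_union))
      exact measure_union_ne_top measure_Ioc_lt_top.ne measure_Ioc_lt_top.ne)
  have hs : B (.inl 0) = Set.Ioc 0 0 := rfl
  have ht : B (.inl 1) = Set.Ioc 0 D := rfl
  have hv : ∀ i, B (.inr i) = if P i then Set.Ioc 0 (x i) else Set.Ioc (D - x i) D := fun _ => rfl
  refine ⟨c, hc, ?_, fun i => ?_, fun i => ?_, fun i j => ?_⟩
  · rw [h, hs, ht, volumeReal_initial_symmDiff_initial le_rfl hD, zero_sub, abs_neg,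
      abs_of_nonneg hD]
  · rw [h, hs, hv]
    split_ifs
    · rw [volumeReal_initial_symmDiff_initial le_rfl (hx i), zero_sub, abs_neg,
        abs_of_nonneg (hx i)]
    · rw [volumeReal_initial_symmDiff_final le_rfl hD (hx i) (hxD i), min_eq_left]
      · ring
      · linarith [hxD i]
  · rw [h, ht, hv]
    split_ifs
    · rw [volumeReal_initial_symmDiff_initial hD (hx i), abs_of_nonneg (by linarith [hxD i])]
    · rw [volumeReal_initial_symmDiff_final hD le_rfl (hx i) (hxD i), min_eq_right]
      · ring
      · linarith [hx i]
  · rw [h, hv, hv]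
    by_cases hi : P i <;> by_cases hj : P j <;> simp only [hi, hj, if_true, if_false, iff_self,
      iff_true, iff_false, not_true]
    · exact volumeReal_initial_symmDiff_initial (hx i) (hx j)
    · exact volumeReal_initial_symmDiff_final (hx i) (hxD i) (hx j) (hxD j)
    · rw [symmDiff_comm, volumeReal_initial_symmDiff_final (hx j) (hxD j) (hx i) (hxD i)]
      congr 1 <;> ring
    · exact volumeReal_final_symmDiff_final (hx i) (hx j)

lemma card_filter_mem_notMem {α : Type*} [Fintype α] [DecidableEq α] {i j : α} (hij : i ≠ j)
    (m : ℕ) :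
    (((univ : Finset α).powersetCard (m + 1)).filter fun S => i ∈ S ∧ j ∉ S).card =
      (Fintype.card α - 2).choose m := by
  have hcard : (((univ : Finset α).erase i).erase j).card = Fintype.card α - 2 := by
    rw [card_erase_of_mem (by simp [hij.symm]), card_erase_of_mem (mem_univ i), card_univ]
    omega
  rw [← hcard, ← card_powersetCard]
  refine card_nbij' (fun S => S.erase i) (fun S => insert i S) ?_ ?_ ?_ ?_
  · intro S hS
    simp only [coe_filter, mem_powersetCard, Set.mem_ofPred_eq, subset_univ, true_and] at hS
    obtain ⟨hS, hi, hj⟩ := hS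
    simp only [mem_coe, mem_powersetCard]
    refine ⟨fun y hy => ?_, by rw [card_erase_of_mem hi, hS]; rfl⟩
    have := mem_of_mem_erase hy
    simp only [mem_erase, mem_univ, and_true] at hy ⊢
    exact ⟨fun h => hj (h ▸ this), hy.1⟩
  · intro S hS
    simp only [mem_coe, mem_powersetCard] at hS
    have hi : i ∉ S := fun h => by simpa using hS.1 h
    have hj : j ∉ S := fun h => by simpa using hS.1 h
    simp [mem_powersetCard, card_insert_of_notMem hi, hS.2, hj, hij.symm]
  · intro S hS
    simp only [coe_filter, Set.mem_ofPred_eq] at hS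
    exact insert_erase hS.2.1
  · intro S hS
    simp only [mem_coe, mem_powersetCard] at hS
    exact erase_insert fun h => by simpa using hS.1 h

/-- A uniformly random `k`-subset of a set of size `2k` separates two given elements with
probability `k / (2k - 1)`. -/
lemma card_separating_powersetCard {k : ℕ} (hk : 1 ≤ k) {i j : Fin (2 * k)} (hij : i ≠ j) :
    (2 * (k : ℝ) - 1) *
      (((univ : Finset (Fin (2 * k))).powersetCard k).filter fun S => ¬ (i ∈ S ↔ j ∈ S)).card =
      k * (((univ : Finset (Fin (2 * k))).powersetCard k).card : ℝ) := by
  obtain ⟨m, rfl⟩ : ∃ m, k = m + 1 := ⟨k - 1, by omega⟩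
  have hsplit : (((univ : Finset (Fin (2 * (m + 1)))).powersetCard (m + 1)).filter
      fun S => ¬ (i ∈ S ↔ j ∈ S)).card = 2 * m.centralBinom := by
    have : ((univ : Finset (Fin (2 * (m + 1)))).powersetCard (m + 1)).filter
        (fun S => ¬ (i ∈ S ↔ j ∈ S)) =
        ((univ : Finset (Fin (2 * (m + 1)))).powersetCard (m + 1)).filter
          (fun S => i ∈ S ∧ j ∉ S) ∪
        ((univ : Finset (Fin (2 * (m + 1)))).powersetCard (m + 1)).filter
          (fun S => j ∈ S ∧ i ∉ S) := by
      rw [← filter_or]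
      refine filter_congr fun S _ => ?_
      tauto
    rw [this, card_union_of_disjoint, card_filter_mem_notMem hij, card_filter_mem_notMem hij.symm,
      Fintype.card_fin, Nat.centralBinom]
    · rw [show 2 * (m + 1) - 2 = 2 * m by omega]; ring
    · exact disjoint_filter.2 fun S _ h h' => h.2 h'.1
  rw [hsplit, card_powersetCard, card_univ, Fintype.card_fin]
  have := Nat.succ_mul_centralBinom_succ m
  rw [Nat.centralBinom] at this
  have h : ((m : ℝ) + 1) * ((2 * (m + 1)).choose (m + 1) : ℝ) =
      2 * (2 * m + 1) * m.centralBinom := by exact_mod_cast this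
  push_cast
  rw [h]
  ring

/-- Averaging the circles over all ways to split `2k` paths into two classes of size `k`, each class
being glued to one arc. -/
lemma exists_averaged_circle_cutDist {n k : ℕ} (hk : 1 ≤ k) (hnk : n ≤ 2 * k) {D : ℝ}
    (hD : 0 ≤ D) (x : Fin n → ℝ) (hx : ∀ i, 0 ≤ x i) (hxD : ∀ i, x i ≤ D) :
    ∃ c : Finset (Fin 2 ⊕ Fin n) → ℝ, 0 ≤ c ∧ cutDist c (.inl 0) (.inl 1) = D ∧
      (∀ i, cutDist c (.inl 0) (.inr i) = x i) ∧ (∀ i, cutDist c (.inl 1) (.inr i) = D - x i) ∧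
      ∀ i j, i ≠ j → (2 * (k : ℝ) - 1) * cutDist c (.inr i) (.inr j) =
        k * min (x i + x j) (2 * D - x i - x j) + (k - 1) * |x i - x j| := by
  set T := (univ : Finset (Fin (2 * k))).powersetCard k with hT
  have hTpos : (0 : ℝ) < T.card := by
    rw [hT, card_powersetCard, card_univ, Fintype.card_fin]
    exact_mod_cast Nat.choose_pos (by omega)
  choose c hc hst hs ht hv using fun S : Finset (Fin (2 * k)) =>
    exists_circle_cutDist hD x hx hxD fun i => Fin.castLE hnk i ∈ S
  have hconst : ∀ u v (r : ℝ), (∀ S, cutDist (c S) u v = r) →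
      cutDist ((T.card : ℝ)⁻¹ • ∑ S ∈ T, c S) u v = r := by
    intro u v r h
    rw [cutDist_smul, cutDist_sum, sum_congr rfl fun S _ => h S, sum_const, nsmul_eq_mul]
    field_simp
  refine ⟨(T.card : ℝ)⁻¹ • ∑ S ∈ T, c S, smul_nonneg (by positivity) (sum_nonneg fun S _ => hc S),
    hconst _ _ _ hst, fun i => hconst _ _ _ fun S => hs S i, fun i => hconst _ _ _ fun S => ht S i,
    fun i j hij => ?_⟩
  have hcount := card_separating_powersetCard hk fun h => hij (Fin.castLE_injective hnk h)
  have hcompl := card_filter_add_card_filter_not (s := T)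
    fun S => Fin.castLE hnk i ∈ S ↔ Fin.castLE hnk j ∈ S
  rw [← hT] at hcount
  rw [cutDist_smul, cutDist_sum, sum_congr rfl fun S _ => hv S i j, sum_ite, sum_const, sum_const,
    nsmul_eq_mul, nsmul_eq_mul]
  generalize (T.filter fun S => Fin.castLE hnk i ∈ S ↔ Fin.castLE hnk j ∈ S).card = p at *
  generalize (T.filter fun S => ¬ (Fin.castLE hnk i ∈ S ↔ Fin.castLE hnk j ∈ S)).card = q at *
  have hp : (p : ℝ) = T.card - q := by
    rw [eq_sub_iff_add_eq]; exact_mod_cast hcompl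
  rw [hp]
  generalize min (x i + x j) (2 * D - x i - x j) = M
  generalize |x i - x j| = N
  field_simp
  linear_combination (M - N) * hcount

/-- Pendant edges of length `r v` lie in the cut cone. -/
lemma exists_pendant_cutDist {V : Type*} [Fintype V] [DecidableEq V] {r : V → ℝ} (hr : 0 ≤ r) :
    ∃ c : Finset V → ℝ, 0 ≤ c ∧ ∀ u v, u ≠ v → cutDist c u v = r u + r v := by
  refine ⟨∑ x, r x • Pi.single {x} 1, ?_, fun u v huv => ?_⟩
  · exact sum_nonneg fun x _ => smul_nonneg (hr x) (Pi.single_nonneg.2 zero_le_one)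
  · have h1 : ∀ x, cutDist (Pi.single {x} 1) u v = cutSep {x} u v := fun x => by
      simp [cutDist, Pi.single_apply]
    simp only [cutDist_sum, cutDist_smul, h1]
    have h2 : ∀ x, r x * cutSep {x} u v =
        (if x = u then r x else 0) + if x = v then r x else 0 := by
      intro x
      by_cases hu : x = u
      · subst hu; simp [cutSep, huv, huv.symm]
      · by_cases hv : x = v
        · subst hv; simp [cutSep, hu, huv]
        · simp [cutSep, hu, hv, Ne.symm hu, Ne.symm hv]
    simp [h2, sum_add_distrib]

/-- Pendant edges of length `p * min x (D - x)` compensate for the distances that the averaged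
circle metric shortens, at a cost of a factor `1 + p`. -/
lemma pendant_correction_bounds {D x y p : ℝ} (hp : 0 ≤ p) (hx : 0 ≤ x) (hxD : x ≤ D)
    (hy : 0 ≤ y) (hyD : y ≤ D) :
    min (x + y) (2 * D - x - y) ≤
        (1 - p) * min (x + y) (2 * D - x - y) + p * |x - y| +
          (p * min x (D - x) + p * min y (D - y)) ∧
      (1 - p) * min (x + y) (2 * D - x - y) + p * |x - y| +
          (p * min x (D - x) + p * min y (D - y)) ≤
        (1 + p) * min (x + y) (2 * D - x - y) := by
  have h1 : min (x + y) (2 * D - x - y) - |x - y| ≤ min x (D - x) + min y (D - y) := by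
    grind
  have h2 : |x - y| ≤ min (x + y) (2 * D - x - y) :=
    le_min (abs_le.2 ⟨by linarith, by linarith⟩) (abs_le.2 ⟨by linarith, by linarith⟩)
  have h3 : min x (D - x) + min y (D - y) ≤ min (x + y) (2 * D - x - y) :=
    le_min (add_le_add (min_le_left _ _) (min_le_left _ _))
      ((add_le_add (min_le_right _ _) (min_le_right _ _)).trans (by linarith))
  have h1' := mul_le_mul_of_nonneg_left h1 hp
  have h2' := mul_le_mul_of_nonneg_left h2 hp
  have h3' := mul_le_mul_of_nonneg_left h3 hp
  constructor <;> linarith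

/-- The cut cone contains an approximation of every metric with the shape of a shortest-path
metric on `K_{2,n}`. -/
lemma exists_cutDist_K2 {n k : ℕ} (hk : 1 ≤ k) (hnk : n ≤ 2 * k)
    {δ : Fin 2 ⊕ Fin n → Fin 2 ⊕ Fin n → ℝ} (hself : ∀ u, δ u u = 0)
    (hcomm : ∀ u v, δ u v = δ v u) (htri : ∀ u v x, δ u x ≤ δ u v + δ v x)
    (hpair : ∀ i j, i ≠ j → δ (.inr i) (.inr j) =
      min (δ (.inl 0) (.inr i) + δ (.inl 0) (.inr j))
        (δ (.inl 1) (.inr i) + δ (.inl 1) (.inr j))) :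
    ∃ c : Finset (Fin 2 ⊕ Fin n) → ℝ, 0 ≤ c ∧ (∀ u v, δ u v ≤ cutDist c u v) ∧
      ∀ u v, cutDist c u v ≤ (3 * (k : ℝ) - 2) / (2 * k - 1) * δ u v := by
  have hnn : ∀ u v, 0 ≤ δ u v := fun u v => by
    have := htri u v u
    rw [hself, hcomm v u] at this
    linarith
  have hk1 : (1 : ℝ) ≤ k := by exact_mod_cast hk
  have hk0 : (0 : ℝ) < 2 * k - 1 := by linarith
  set p : ℝ := (k - 1) / (2 * k - 1) with hp
  have hp0 : 0 ≤ p := div_nonneg (by linarith) hk0.le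
  have hkp : (k : ℝ) - 1 = (2 * k - 1) * p := (mul_div_cancel₀ _ hk0.ne').symm
  have h1p : (k : ℝ) = (2 * k - 1) * (1 - p) := by linarith
  have hα : (3 * (k : ℝ) - 2) / (2 * k - 1) = 1 + p := by
    rw [div_eq_iff hk0.ne']
    linarith
  set D := δ (.inl 0) (.inl 1) with hD
  set a : Fin n → ℝ := fun i => δ (.inl 0) (.inr i) with ha
  set b : Fin n → ℝ := fun i => δ (.inl 1) (.inr i) with hb
  have h1 : ∀ i, D ≤ a i + b i := fun i => by
    have := htri (.inl 0) (.inr i) (.inl 1)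
    rwa [hcomm (.inr i) (.inl 1)] at this
  have h2 : ∀ i, a i ≤ D + b i := fun i => htri (.inl 0) (.inl 1) (.inr i)
  have h3 : ∀ i, b i ≤ D + a i := fun i => by
    have := htri (.inl 1) (.inl 0) (.inr i)
    rwa [hcomm (.inl 1) (.inl 0)] at this
  -- The vertex `inr i` hangs on an edge of length `h i` at the point at distance `x i` from `inl 0`
  -- of a path of length `D`.
  set x : Fin n → ℝ := fun i => (a i - b i + D) / 2 with hx
  set h : Fin n → ℝ := fun i => (a i + b i - D) / 2 with hh
  have hx0 : ∀ i, 0 ≤ x i := fun i => by simp only [hx]; linarith [h3 i]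
  have hxD : ∀ i, x i ≤ D := fun i => by simp only [hx]; linarith [h2 i]
  have hh0 : ∀ i, 0 ≤ h i := fun i => by simp only [hh]; linarith [h1 i]
  have hax : ∀ i, a i = h i + x i := fun i => by simp only [hx, hh]; ring
  have hbx : ∀ i, b i = h i + (D - x i) := fun i => by simp only [hx, hh]; ring
  have hm0 : ∀ i, 0 ≤ min (x i) (D - x i) := fun i => le_min (hx0 i) (by linarith [hxD i])
  obtain ⟨c₁, hc₁, hst, hs, ht, hv⟩ :=
    exists_averaged_circle_cutDist hk hnk (hnn (.inl 0) (.inl 1)) x hx0 hxD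
  obtain ⟨c₂, hc₂, hr⟩ := exists_pendant_cutDist
    (r := (Sum.elim (fun _ => 0) fun i => h i + p * min (x i) (D - x i) : Fin 2 ⊕ Fin n → ℝ))
    (by
      rintro (_ | i)
      · exact le_rfl
      · exact add_nonneg (hh0 i) (mul_nonneg hp0 (hm0 i)))
  have hb_st : D ≤ cutDist (c₁ + c₂) (.inl 0) (.inl 1) ∧
      cutDist (c₁ + c₂) (.inl 0) (.inl 1) ≤ (1 + p) * D := by
    rw [cutDist_add, hst, hr _ _ (by simp)]
    have : 0 ≤ D := hnn _ _
    constructor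
    · simp [hD]
    · simp only [Sum.elim_inl, ← hD]; nlinarith
  have hb_s : ∀ i, a i ≤ cutDist (c₁ + c₂) (.inl 0) (.inr i) ∧
      cutDist (c₁ + c₂) (.inl 0) (.inr i) ≤ (1 + p) * a i := by
    intro i
    rw [cutDist_add, hs, hr _ _ (by simp), hax]
    simp only [Sum.elim_inl, Sum.elim_inr]
    constructor
    · nlinarith [hm0 i]
    · nlinarith [min_le_left (x i) (D - x i), hh0 i]
  have hb_t : ∀ i, b i ≤ cutDist (c₁ + c₂) (.inl 1) (.inr i) ∧
      cutDist (c₁ + c₂) (.inl 1) (.inr i) ≤ (1 + p) * b i := by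
    intro i
    rw [cutDist_add, ht, hr _ _ (by simp), hbx]
    simp only [Sum.elim_inl, Sum.elim_inr]
    constructor
    · nlinarith [hm0 i]
    · nlinarith [min_le_right (x i) (D - x i), hh0 i]
  have hb_v : ∀ i j, δ (.inr i) (.inr j) ≤ cutDist (c₁ + c₂) (.inr i) (.inr j) ∧
      cutDist (c₁ + c₂) (.inr i) (.inr j) ≤ (1 + p) * δ (.inr i) (.inr j) := by
    intro i j
    by_cases hij : i = j
    · subst hij; simp [cutDist_self, hself]
    have hc : cutDist c₁ (.inr i) (.inr j) =
        (1 - p) * min (x i + x j) (2 * D - x i - x j) + p * |x i - x j| := by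
      have := hv i j hij
      rw [hkp] at this
      nth_rewrite 2 [h1p] at this
      refine mul_left_cancel₀ hk0.ne' (this.trans ?_)
      ring
    have hδ : δ (.inr i) (.inr j) = h i + h j + min (x i + x j) (2 * D - x i - x j) := by
      rw [hpair i j hij, ← min_add_add_left]
      change min (a i + a j) (b i + b j) = _
      rw [hax, hax, hbx, hbx]
      congr 1 <;> ring
    obtain ⟨hlo, hhi⟩ := pendant_correction_bounds (D := D) (x := x i) (y := x j) hp0 (hx0 i)
      (hxD i) (hx0 j) (hxD j)
    rw [cutDist_add, hc, hr _ _ (by simpa using hij), hδ]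
    simp only [Sum.elim_inr]
    constructor
    · linarith
    · nlinarith [hh0 i, hh0 j]
  have hall : ∀ u v, δ u v ≤ cutDist (c₁ + c₂) u v ∧
      cutDist (c₁ + c₂) u v ≤ (1 + p) * δ u v := by
    have hsymm : ∀ u v, (δ u v ≤ cutDist (c₁ + c₂) u v ∧
        cutDist (c₁ + c₂) u v ≤ (1 + p) * δ u v) → (δ v u ≤ cutDist (c₁ + c₂) v u ∧
        cutDist (c₁ + c₂) v u ≤ (1 + p) * δ v u) := fun u v h => by
      rwa [hcomm v u, cutDist_comm _ v u]
    have hdiag : ∀ u, δ u u ≤ cutDist (c₁ + c₂) u u ∧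
        cutDist (c₁ + c₂) u u ≤ (1 + p) * δ u u := fun u => by simp [hself, cutDist_self]
    have hlr : ∀ (e : Fin 2) (i : Fin n),
        δ (.inl e) (.inr i) ≤ cutDist (c₁ + c₂) (.inl e) (.inr i) ∧
        cutDist (c₁ + c₂) (.inl e) (.inr i) ≤ (1 + p) * δ (.inl e) (.inr i) := by
      intro e i
      fin_cases e
      · exact hb_s i
      · exact hb_t i
    rintro (e | i) (e' | j)
    · fin_cases e <;> fin_cases e'
      · exact hdiag _
      · exact hb_st
      · exact hsymm _ _ hb_st
      · exact hdiag _
    · exact hlr e j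
    · exact hsymm _ _ (hlr e' i)
    · exact hb_v i j
  rw [hα]
  exact ⟨c₁ + c₂, add_nonneg hc₁ hc₂, fun u v => (hall u v).1, fun u v => (hall u v).2⟩

/-- Every weighting of `K_{2,n}` with `n ≤ 2k` embeds with distortion at most
`(3k - 2) / (2k - 1)`. -/
lemma exists_distortion_le {n k : ℕ} (hn : 0 < n) (hk : 1 ≤ k) (hnk : n ≤ 2 * k)
    (w : (K2 n).edgeSet → ℝ≥0) :
    ∃ f : Fin 2 ⊕ Fin n → EllOne, IsMetricEmbedding (pathDist (K2 n) w) f ∧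
      distortion (pathDist (K2 n) w) f ≤
        ENNReal.ofReal ((3 * (k : ℝ) - 2) / (2 * k - 1)) := by
  have hd : ∀ u v, pathDist (K2 n) w u v ≠ ⊤ := pathDist_ne_top w (K2_connected hn)
  obtain ⟨c, hc, hlo, hhi⟩ := exists_cutDist_K2 hk hnk
    (δ := fun u v => (pathDist (K2 n) w u v).toReal)
    (fun u => by simp [pathDist_self]) (fun u v => by rw [pathDist_comm])
    (fun u v x => by
      rw [← ENNReal.toReal_add (hd _ _) (hd _ _)]
      exact ENNReal.toReal_mono (ENNReal.add_ne_top.2 ⟨hd _ _, hd _ _⟩)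
        (pathDist_triangle w u v x))
    (fun i j hij => by
      rw [pathDist_inr_inr w hij, ENNReal.toReal_min (ENNReal.add_ne_top.2 ⟨hd _ _, hd _ _⟩)
        (ENNReal.add_ne_top.2 ⟨hd _ _, hd _ _⟩), ENNReal.toReal_add (hd _ _) (hd _ _),
        ENNReal.toReal_add (hd _ _) (hd _ _)])
  obtain ⟨f, hf⟩ := exists_dist_eq_cutDist hc
  have hE := fun u v => (hf u v).le.trans (hhi u v)
  have hC : ∀ u v, (pathDist (K2 n) w u v).toReal ≤ 1 * dist (f u) (f v) := fun u v => by
    rw [hf, one_mul]; exact hlo u v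
  have hk1 : (1 : ℝ) ≤ k := by exact_mod_cast hk
  refine ⟨f, isMetricEmbedding_of_le hd hE hC, ?_⟩
  have := distortion_le_of_le hd (div_nonneg (by linarith) (by linarith)) hE hC
  rwa [mul_one] at this

end UpperBound

end L1Distortion

theorem mainTheorem1 (n : ℕ) (hn : 0 < n) :
    (∀ w : (completeBipartiteGraph (Fin 2) (Fin n)).edgeSet → ℝ≥0,
      IsLeast (L1Distortion.ellOneDistortions (completeBipartiteGraph (Fin 2) (Fin n)) w)
        (L1Distortion.weightedC1 (completeBipartiteGraph (Fin 2) (Fin n)) w)) ∧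
    L1Distortion.c1 (completeBipartiteGraph (Fin 2) (Fin n)) =
      ENNReal.ofReal
        ((3 * (⌈(n : ℝ) / 2⌉₊ : ℝ) - 2) / (2 * (⌈(n : ℝ) / 2⌉₊ : ℝ) - 1)) := by
  set k := ⌈(n : ℝ) / 2⌉₊ with hkdef
  have hnR : (0 : ℝ) < n := by exact_mod_cast hn
  have hk : 1 ≤ k := Nat.one_le_ceil_iff.2 (by linarith)
  have hnk : n ≤ 2 * k := by
    have := Nat.le_ceil ((n : ℝ) / 2)
    rw [← hkdef] at this
    have h : (n : ℝ) ≤ 2 * k := by linarith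
    exact_mod_cast h
  have hkn : 2 * k - 1 ≤ n := by
    have := Nat.ceil_lt_add_one (show (0 : ℝ) ≤ (n : ℝ) / 2 by linarith)
    rw [← hkdef] at this
    have h : 2 * (k : ℝ) < n + 2 := by linarith
    have h' : 2 * k < n + 2 := by exact_mod_cast h
    omega
  constructor
  · intro w
    obtain ⟨f, hf, hle⟩ := L1Distortion.exists_distortion_le hn hk hnk w
    obtain ⟨D, hD⟩ := L1Distortion.exists_isLeast_distortion
      (L1Distortion.pathDist_ne_top w (L1Distortion.K2_connected hn))
      ⟨f, hf, ne_top_of_le_ne_top ENNReal.ofReal_ne_top hle⟩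
    have hw : L1Distortion.weightedC1 (completeBipartiteGraph (Fin 2) (Fin n)) w = D :=
      hD.isGLB.sInf_eq
    rw [hw]
    exact hD
  · refine le_antisymm (iSup_le fun w => ?_) (le_iSup_of_le (fun _ => 1) (le_sInf ?_))
    · obtain ⟨f, hf, hle⟩ := L1Distortion.exists_distortion_le hn hk hnk w
      exact sInf_le_of_le ⟨f, hf, rfl⟩ hle
    · rintro _ ⟨f, hf, rfl⟩
      exact L1Distortion.le_distortion_one hk hkn hf
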